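/- Let $(X,\mathcal B)$ be a standard Borel space and $\mu$ a $\sigma$-finite measure on it with $\mu(\{x\})=0$ for every $x\in X$ and $\mu(X)=\infty$. Let $X^*$ be the set of countable subsets of $X$, with the $\sigma$-algebra $\mathcal B^*$ generated by the sets $\{\omega\in X^*: |\omega\cap B|=n\}$ ($B\in\mathcal B$, $n\ge 0$), and let $\mu^*$ be the law on $(X^*,\mathcal B^*)$ of the Poisson point process with intensity $\mu$, i.e. the probability measure under which, for pairwise disjoint $A_1,\dots,A_n\in\mathcal B$, the variables $|\omega\cap A_i|$ are jointly independent and Poisson distributed with mean $\mu(A_i)$ (almost surely infinite if $\mu(A_i)=\infty$). Let a group $G$ act on $X$ by measurable, $\mu$-preserving transformations $T_g$, $g\in G$, and let $T\times T_*$ be the action of $G$ on $(X\times X^*,\mu\times\mu^*)$ given by $(x,\omega)\mapsto (T_gx,\{T_gy: y\in\omega\})$. Assume that $T\times T_*$ is ergodic: every measurable set $A\subseteq X\times X^*$ that is, for each $g\in G$, invariant under $g$ up to a $\mu\times\mu^*$-null set is null or has null complement. Let $\Phi\colon X\to L^1(\mu)$, $x\mapsto\Phi_x$ (real or complex $L^1$),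 be Borel measurable and $T$-equivariant: for every $g\in G$ and $\mu$-almost every $x\in X$, $\Phi_{T_gx}\circ T_g=\Phi_x$ in $L^1(\mu)$. Then $\Phi_x=0$ for $\mu$-almost every $x\in X$. -/

import Mathlib

open MeasureTheory ProbabilityTheory

/-- The space of countable subsets of `X`, on which the Poisson point process lives. -/
@[ext]
structure CountableSubset (X : Type*) where
  /-- The set of points. -/
  carrier : Set X
  countable : carrier.Countable

namespace CountableSubset

/-- The number `|ω ∩ B|` of points of `ω` in `B`, possibly infinite. -/
noncomputable def count {X : Type*} (ω : CountableSubset X) (B : Set X) : ℕ∞ :=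
  (ω.carrier ∩ B).encard

/-- The σ-algebra generated by the sets `{ω : |ω ∩ B| = n}`, with `B` measurable and `n : ℕ`. -/
instance instMeasurableSpace {X : Type*} [MeasurableSpace X] :
    MeasurableSpace (CountableSubset X) :=
  MeasurableSpace.generateFrom
    {S | ∃ (B : Set X) (n : ℕ), MeasurableSet B ∧
      S = {ω : CountableSubset X | ω.count B = (n : ℕ∞)}}

/-- The action induced on countable subsets: `g • ω = {g • x : x ∈ ω}`. If `G` acts on `X` by
measure-preserving transformations, this is the Poisson suspension of the action. -/
instance instMulAction {G X : Type*} [Group G] [MulAction G X] :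
    MulAction G (CountableSubset X) where
  smul g ω := ⟨(fun x => g • x) '' ω.carrier, ω.countable.image _⟩
  one_smul ω := CountableSubset.ext (by
    change (fun x => (1 : G) • x) '' ω.carrier = ω.carrier
    simp)
  mul_smul g h ω := CountableSubset.ext (by
    change (fun x => (g * h) • x) '' ω.carrier = (fun x => g • x) '' ((fun x => h • x) '' ω.carrier)
    simp [Set.image_image, mul_smul])

end CountableSubset

/-- `P` is the law of the Poisson point process with intensity `μ`: a probability measure on the
countable subsets of `X` under which the numbers of points in pairwise disjoint measurable sets
are jointly independent, the number of points in `A` being Poisson with mean `μ A`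
(and almost surely infinite if `μ A = ∞`). -/
structure IsPoissonPointProcess {X : Type*} [MeasurableSpace X] (μ : Measure X)
    (P : Measure (CountableSubset X)) : Prop where
  isProbabilityMeasure : IsProbabilityMeasure P
  measure_count_eq : ∀ A : Set X, MeasurableSet A → μ A ≠ ⊤ → ∀ k : ℕ,
    P {ω | ω.count A = (k : ℕ∞)} =
      ENNReal.ofReal (Real.exp (-(μ A).toReal) * (μ A).toReal ^ k / (k.factorial : ℝ))
  measure_count_eq_top : ∀ A : Set X, MeasurableSet A → μ A = ⊤ → P {ω | ω.count A = ⊤} = 1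
  iIndepFun_count : ∀ (n : ℕ) (A : Fin n → Set X), (∀ i, MeasurableSet (A i)) →
    Pairwise (fun i j => Disjoint (A i) (A j)) →
    iIndepFun (fun (i : Fin n) (ω : CountableSubset X) => ω.count (A i)) P

/-!
If `A ⊆ Y × X` is invariant under `G`, so is the set of pairs `(y, ω)` such that `ω` avoids the
section `A_y`. When `μ (A_y) < ∞`, the section of that set at `y` has probability
`exp (-μ (A_y)) > 0`, so ergodicity forces it to be of full measure, and hence `μ (A_y) = 0` for
almost every `y`.

An equivariant family of finite measures `κ_y ≪ μ` has a joint density with respect to `ν × μ`,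
which is invariant because `∫ δ_y ⊗ κ_y dν(y)` and `ν × μ` both are. By Markov's inequality its
superlevel sets have sections of finite measure, so they are null and `κ_y = 0` almost everywhere.
The family `κ_y = ‖Φ_y‖ ^ p dμ` is of this kind.
-/

open Filter Function Set
open scoped ENNReal

theorem isSFiniteKernel_of_isFiniteMeasure {α β : Type*} [MeasurableSpace α] [MeasurableSpace β]
    (κ : Kernel α β) [∀ a, IsFiniteMeasure (κ a)] : IsSFiniteKernel κ := by
  classical
  let mass : α → ℕ := fun a => ⌊(κ a univ).toReal⌋₊
  have hmass (n : ℕ) : MeasurableSet {a | mass a = n} :=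
    (Nat.measurable_floor.comp (κ.measurable_coe .univ).ennreal_toReal) (measurableSet_singleton n)
  have hsum : κ = Kernel.sum fun n => Kernel.piecewise (hmass n) κ 0 := by
    ext a s hs
    rw [Kernel.sum_apply' _ _ hs, tsum_eq_single (mass a)]
    · simp [Kernel.piecewise_apply']
    · intro n hn
      simp [Kernel.piecewise_apply', hn.symm]
  have hfin (n : ℕ) : IsFiniteKernel (Kernel.piecewise (hmass n) κ 0) := by
    refine ⟨⟨n + 1, by simp, fun a => ?_⟩⟩
    rw [Kernel.piecewise_apply']
    split_ifs with ha
    · have hlt : (κ a univ).toReal < n + 1 :=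
        (show mass a = n from ha) ▸ Nat.lt_floor_add_one (κ a univ).toReal
      exact (ENNReal.toReal_le_toReal (measure_ne_top _ _) (by simp)).1
        (by simpa [ENNReal.toReal_add] using hlt.le)
    · simp
  rw [hsum]
  infer_instance

namespace CountableSubset

variable {X : Type*}

theorem count_eq_zero {ω : CountableSubset X} {B : Set X} :
    ω.count B = 0 ↔ Disjoint ω.carrier B := by
  rw [count, encard_eq_zero, disjoint_iff_inter_eq_empty]

theorem count_mono {ω : CountableSubset X} {A B : Set X} (h : A ⊆ B) : ω.count A ≤ ω.count B :=
  encard_le_encard (inter_subset_inter_right _ h)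

theorem count_smul {G : Type*} [Group G] [MulAction G X] (g : G)
    (ω : CountableSubset X) (B : Set X) :
    (g • ω).count B = ω.count ((g • ·) ⁻¹' B) := by
  change ((g • ·) '' ω.carrier ∩ B).encard = _
  rw [← image_inter_preimage, (MulAction.injective g).encard_image, count]

theorem setOf_count_ne_top (B : Set X) :
    {ω : CountableSubset X | ω.count B ≠ ⊤} = ⋃ n : ℕ, {ω | ω.count B = (n : ℕ∞)} := by
  ext ω
  simp [ENat.ne_top_iff_exists, eq_comm]

variable [MeasurableSpace X]

theorem measurableSet_count_eq {B : Set X} (hB : MeasurableSet B) (n : ℕ) :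
    MeasurableSet {ω : CountableSubset X | ω.count B = (n : ℕ∞)} :=
  MeasurableSpace.measurableSet_generateFrom ⟨B, n, hB, rfl⟩

theorem measurable_count {B : Set X} (hB : MeasurableSet B) :
    Measurable fun ω : CountableSubset X => ω.count B := by
  refine measurable_to_countable' fun n => ?_
  induction n using ENat.recTopCoe with
  | coe n => exact measurableSet_count_eq hB n
  | top =>
    have h : (fun ω : CountableSubset X => ω.count B) ⁻¹' {⊤} =
        (⋃ n : ℕ, {ω | ω.count B = (n : ℕ∞)})ᶜ := by
      rw [← setOf_count_ne_top]
      ext ω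
      simp
    rw [h]
    exact (MeasurableSet.iUnion (measurableSet_count_eq hB)).compl

instance instMeasurableConstSMul {G : Type*} [Group G] [MulAction G X]
    [MeasurableConstSMul G X] : MeasurableConstSMul G (CountableSubset X) where
  measurable_const_smul g := by
    refine measurable_generateFrom ?_
    rintro _ ⟨B, n, hB, rfl⟩
    simp only [preimage_ofPred_eq, count_smul]
    exact measurableSet_count_eq (measurable_const_smul g hB) n

theorem map_count_apply (ω : CountableSubset X) {B : Set X} (hB : MeasurableSet B) :
    (Measure.count : Measure ω.carrier).map Subtype.val B = (ω.count B : ℝ≥0∞) := by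
  rw [Measure.map_apply measurable_subtype_coe hB,
    Measure.count_apply (measurable_subtype_coe hB), count,
    ← Subtype.val_injective.encard_image, Subtype.image_preimage_coe]

/-- The kernel sending a configuration `ω` to the counting measure of its points,
`B ↦ |ω ∩ B|`. -/
noncomputable def countKernel (X : Type*) [MeasurableSpace X] : Kernel (CountableSubset X) X where
  toFun ω := (Measure.count : Measure ω.carrier).map Subtype.val
  measurable' := Measure.measurable_of_measurable_coe _ fun B hB => by
    simp only [map_count_apply _ hB]
    exact (measurable_of_countable _).comp (measurable_count hB)

theorem countKernel_apply (ω : CountableSubset X) {B : Set X} (hB : MeasurableSet B) :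
    countKernel X ω B = (ω.count B : ℝ≥0∞) :=
  map_count_apply ω hB

end CountableSubset

namespace IsPoissonPointProcess

variable {X : Type*} [MeasurableSpace X] {μ : Measure X} {P : Measure (CountableSubset X)}

theorem measure_count_eq_zero (hP : IsPoissonPointProcess μ P) {A : Set X}
    (hA : MeasurableSet A) (hμA : μ A ≠ ∞) :
    P {ω | ω.count A = 0} = ENNReal.ofReal (Real.exp (-(μ A).toReal)) := by
  simpa using hP.measure_count_eq A hA hμA 0

theorem ae_count_ne_top (hP : IsPoissonPointProcess μ P) {A : Set X} (hA : MeasurableSet A)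
    (hμA : μ A ≠ ∞) : ∀ᵐ ω ∂P, ω.count A ≠ ⊤ := by
  have := hP.isProbabilityMeasure
  have hmeas (n : ℕ) := CountableSubset.measurableSet_count_eq hA n
  suffices h : P (⋃ n : ℕ, {ω | ω.count A = (n : ℕ∞)}) = 1 by
    rw [← mem_ae_iff_prob_eq_one (.iUnion hmeas), ← CountableSubset.setOf_count_ne_top] at h
    exact h
  have hdisj : Pairwise (Disjoint on fun n : ℕ => {ω : CountableSubset X | ω.count A = n}) :=
    fun m n hmn => disjoint_left.2 fun ω hm hn => hmn (ENat.natCast_inj.1 (hm.symm.trans hn))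
  have hsum : HasSum
      (fun n : ℕ => Real.exp (-(μ A).toReal) * (μ A).toReal ^ n / (n.factorial : ℝ)) 1 :=
    hasSum_one_poissonMeasure (μ A).toNNReal
  rw [measure_iUnion hdisj hmeas, tsum_congr (hP.measure_count_eq A hA hμA),
    ← ENNReal.ofReal_tsum_of_nonneg (fun n => by positivity) hsum.summable, hsum.tsum_eq,
    ENNReal.ofReal_one]

theorem not_ae_count_ne_zero (hP : IsPoissonPointProcess μ P) {A : Set X}
    (hA : MeasurableSet A) (hμA : μ A ≠ ∞) : ¬ ∀ᵐ ω ∂P, ω.count A ≠ 0 := by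
  intro h
  have h0 : P {ω | ω.count A = 0} = 0 := measure_eq_zero_iff_ae_notMem.2 h
  rw [hP.measure_count_eq_zero hA hμA, ENNReal.ofReal_eq_zero] at h0
  exact (Real.exp_pos _).not_ge h0

theorem ae_count_eq_zero_iff (hP : IsPoissonPointProcess μ P) {A : Set X}
    (hA : MeasurableSet A) (hμA : μ A ≠ ∞) : (∀ᵐ ω ∂P, ω.count A = 0) ↔ μ A = 0 := by
  have := hP.isProbabilityMeasure
  have h : (∀ᵐ ω ∂P, ω.count A = 0) ↔ P {ω | ω.count A = 0} = 1 :=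
    mem_ae_iff_prob_eq_one (CountableSubset.measurableSet_count_eq hA 0)
  rw [h, hP.measure_count_eq_zero hA hμA, ENNReal.ofReal_eq_one, Real.exp_eq_one_iff,
    neg_eq_zero, ENNReal.toReal_eq_zero_iff, or_iff_left hμA]

/-- Joint measurability of `(y, ω) ↦ |ω ∩ A_y|` requires an s-finite kernel. A configuration may
have infinitely many points in a set of finite intensity, but almost none does. -/
theorem exists_isSFiniteKernel_ae_eq_countKernel [SigmaFinite μ]
    (hP : IsPoissonPointProcess μ P) :
    ∃ η : Kernel (CountableSubset X) X, IsSFiniteKernel η ∧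
      ∀ᵐ ω ∂P, η ω = CountableSubset.countKernel X ω := by
  classical
  let E : ℕ → Set X := disjointed (spanningSets μ)
  have hE (n : ℕ) : MeasurableSet (E n) :=
    .disjointed (measurableSet_spanningSets μ) n
  have hμE (n : ℕ) : μ (E n) ≠ ∞ :=
    ((measure_mono (disjointed_subset _ n)).trans_lt (measure_spanningSets_lt_top μ n)).ne
  have hfinite (n : ℕ) : MeasurableSet {ω : CountableSubset X | ω.count (E n) ≠ ⊤} :=
    CountableSubset.measurable_count (hE n) (measurableSet_singleton ⊤).compl
  let η (n : ℕ) : Kernel (CountableSubset X) X :=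
    Kernel.piecewise (hfinite n) ((CountableSubset.countKernel X).restrict (hE n)) 0
  have hη (n : ℕ) : IsSFiniteKernel (η n) := by
    have (ω : CountableSubset X) : IsFiniteMeasure (η n ω) := by
      refine ⟨?_⟩
      rw [Kernel.piecewise_apply']
      split_ifs with hω
      · rw [Kernel.restrict_apply, Measure.restrict_apply_univ,
          CountableSubset.countKernel_apply ω (hE n), ENat.toENNReal_lt_top]
        exact lt_top_iff_ne_top.2 hω
      · simp
    exact isSFiniteKernel_of_isFiniteMeasure (η n)
  refine ⟨Kernel.sum η, inferInstance, ?_⟩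
  filter_upwards [ae_all_iff.2 fun n => hP.ae_count_ne_top (hE n) (hμE n)] with ω hω
  have hηω (n : ℕ) : η n ω = (CountableSubset.countKernel X ω).restrict (E n) := by
    rw [Kernel.piecewise_apply, if_pos (show _ ∈ _ from hω n), Kernel.restrict_apply]
  rw [Kernel.sum_apply, funext hηω, ← Measure.restrict_iUnion
    (disjoint_disjointed _) hE, iUnion_disjointed, iUnion_spanningSets, Measure.restrict_univ]

end IsPoissonPointProcess

section VoidSet

variable {X Y : Type*}

/-- The set of pairs `(y, ω)` such that `ω` has no point in the section of `A` at `y`. The section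
of `voidSet A` at `y` is the event whose probabilities are the void probabilities of the
point process. -/
def voidSet (A : Set (Y × X)) : Set (Y × CountableSubset X) :=
  {p | p.2.count (Prod.mk p.1 ⁻¹' A) = 0}

theorem voidSet_anti : Antitone (voidSet : Set (Y × X) → Set (Y × CountableSubset X)) :=
  fun _ _ h p (hp : p.2.count _ = 0) =>
    nonpos_iff_eq_zero.1 ((CountableSubset.count_mono (preimage_mono h)).trans hp.le)

theorem preimage_smul_voidSet {G : Type*} [Group G] [MulAction G X] [MulAction G Y] (g : G)
    (A : Set (Y × X)) : (g • ·) ⁻¹' voidSet A = voidSet ((g • ·) ⁻¹' A) := by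
  ext p
  simp only [voidSet, mem_preimage, mem_ofPred_eq, Prod.smul_snd, CountableSubset.count_smul]
  rfl

theorem voidSet_union (A B : Set (Y × X)) : voidSet (A ∪ B) = voidSet A ∩ voidSet B := by
  ext p
  simp only [voidSet, mem_ofPred_eq, mem_inter_iff, preimage_union, CountableSubset.count_eq_zero,
    disjoint_union_right]

variable [MeasurableSpace X] [MeasurableSpace Y] {μ : Measure X} {ν : Measure Y}
  {P : Measure (CountableSubset X)}

namespace IsPoissonPointProcess

theorem nullMeasurableSet_voidSet [SigmaFinite μ] (hP : IsPoissonPointProcess μ P)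
    {A : Set (Y × X)} (hA : MeasurableSet A) : NullMeasurableSet (voidSet A) (ν.prod P) := by
  obtain ⟨η, hη, hηP⟩ := hP.exists_isSFiniteKernel_ae_eq_countKernel
  have hmeas : Measurable fun p : Y × CountableSubset X => η p.2 (Prod.mk p.1 ⁻¹' A) :=
    Kernel.measurable_kernel_prodMk_left (κ := η.prodMkLeft Y)
      (t := {q | (q.1.1, q.2) ∈ A}) (measurable_fst.fst.prodMk measurable_snd hA)
  refine (hmeas (measurableSet_singleton 0)).nullMeasurableSet.congr ?_
  filter_upwards [Measure.quasiMeasurePreserving_snd.ae hηP] with p hp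
  refine propext ?_
  change η p.2 (Prod.mk p.1 ⁻¹' A) = 0 ↔ p.2.count _ = 0
  rw [hp, CountableSubset.countKernel_apply _ (measurable_prodMk_left hA), ENat.toENNReal_eq_zero]

theorem ae_mem_voidSet [SigmaFinite μ] [SFinite ν] (hP : IsPoissonPointProcess μ P)
    {N : Set (Y × X)} (hN : ν.prod μ N = 0) : ∀ᵐ p ∂ν.prod P, p ∈ voidSet N := by
  have := hP.isProbabilityMeasure
  wlog hmeas : MeasurableSet N generalizing N
  · filter_upwards [this (measure_toMeasurable N ▸ hN) (measurableSet_toMeasurable _ _)] with p hp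
    exact voidSet_anti (subset_toMeasurable _ _) hp
  obtain ⟨T, hT, hTN⟩ := hP.nullMeasurableSet_voidSet (ν := ν) hmeas
  suffices h : ∀ᵐ p ∂ν.prod P, p ∈ T by
    filter_upwards [h, hTN] with p hp hpT using hpT.mpr hp
  rw [Measure.ae_prod_mem_iff_ae_ae_mem hT]
  filter_upwards [Measure.ae_ae_of_ae_prod hTN, (Measure.measure_prod_null hmeas).1 hN]
    with y hy hμy
  have hvoid := (hP.ae_count_eq_zero_iff (measurable_prodMk_left hmeas) (by simp [hμy])).2 hμy
  filter_upwards [hy, hvoid] with ω hω hωN using hω.mp hωN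

theorem voidSet_ae_eq [SigmaFinite μ] [SFinite ν] (hP : IsPoissonPointProcess μ P)
    {A B : Set (Y × X)} (h : A =ᵐ[ν.prod μ] B) : voidSet A =ᵐ[ν.prod P] voidSet B := by
  have hle {A B : Set (Y × X)} (h : A ≤ᵐ[ν.prod μ] B) : voidSet B ≤ᵐ[ν.prod P] voidSet A := by
    filter_upwards [hP.ae_mem_voidSet (ae_le_set.1 h)] with p hp hpB
    exact voidSet_anti (subset_sdiff_union A B) ((voidSet_union _ _).ge ⟨hp, hpB⟩)
  exact (hle h.symm.le).antisymm (hle h.le)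

theorem prod_eq_zero_of_preimage_smul_ae_eq [SigmaFinite μ] [SFinite ν]
    {G : Type*} [Group G] [MulAction G X] [MulAction G Y]
    (hP : IsPoissonPointProcess μ P) [ErgodicSMul G (Y × CountableSubset X) (ν.prod P)]
    {A : Set (Y × X)} (hA : MeasurableSet A) (hfin : ∀ᵐ y ∂ν, μ (Prod.mk y ⁻¹' A) ≠ ∞)
    (hinv : ∀ g : G, (g • ·) ⁻¹' A =ᵐ[ν.prod μ] A) : ν.prod μ A = 0 := by
  have := hP.isProbabilityMeasure
  have hconst : EventuallyConst (voidSet A) (ae (ν.prod P)) :=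
    aeconst_of_forall_preimage_smul_ae_eq G (hP.nullMeasurableSet_voidSet hA) fun g => by
      rw [preimage_smul_voidSet]
      exact hP.voidSet_ae_eq (hinv g)
  rw [Measure.measure_prod_null hA]
  rcases eventuallyConst_set.1 hconst with hall | hnone
  · filter_upwards [hfin, Measure.ae_ae_of_ae_prod hall] with y hy hvoid
    exact (hP.ae_count_eq_zero_iff (measurable_prodMk_left hA) hy).1 hvoid
  · filter_upwards [hfin, Measure.ae_ae_of_ae_prod hnone] with y hy hhit
    exact absurd hhit (hP.not_ae_count_ne_zero (measurable_prodMk_left hA) hy)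

end IsPoissonPointProcess

end VoidSet

section Density

variable {α β : Type*} [MeasurableSpace α] [MeasurableSpace β]

theorem map_withDensity_comp {m : Measure α} {m' : Measure β} {e : α → β}
    (he : MeasurePreserving e m m') {f : β → ℝ≥0∞} (hf : AEMeasurable f m') :
    (m.withDensity (f ∘ e)).map e = m'.withDensity f := by
  ext s hs
  have hes := he.restrict_preimage hs
  rw [Measure.map_apply he.measurable hs, withDensity_apply _ (he.measurable hs),
    withDensity_apply _ hs, ← hes.map_eq,
    lintegral_map' (hes.map_eq ▸ hf.restrict) hes.aemeasurable]
  rfl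

theorem comp_ae_eq_of_measurePreserving_withDensity {m : Measure α} [SigmaFinite m]
    {f : α → ℝ≥0∞} (hf : AEMeasurable f m) {e : α ≃ᵐ α} (hm : MeasurePreserving e m m)
    (hmf : MeasurePreserving e (m.withDensity f) (m.withDensity f)) : f ∘ e =ᵐ[m] f :=
  (withDensity_eq_iff_of_sigmaFinite (hf.comp_quasiMeasurePreserving hm.quasiMeasurePreserving)
    hf).1 <| e.map_measurableEquiv_injective <| (map_withDensity_comp hm hf).trans hmf.map_eq.symm

theorem withDensity_eq_zero_of_forall_measure_ge_eq_zero {m : Measure α} {f : α → ℝ≥0∞}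
    (hf : AEMeasurable f m) (h : ∀ c : ℝ≥0∞, c ≠ 0 → c ≠ ∞ → m {a | c ≤ f a} = 0) :
    m.withDensity f = 0 := by
  rw [withDensity_eq_zero_iff hf]
  have hlevel (n : ℕ) : ∀ᵐ a ∂m, ¬ (n + 1 : ℝ≥0∞)⁻¹ ≤ f a :=
    measure_eq_zero_iff_ae_notMem.1 (h _ (by simp) (by simp))
  filter_upwards [ae_all_iff.2 hlevel] with a ha
  by_contra hne
  obtain ⟨n, hn⟩ := ENNReal.exists_inv_nat_lt hne
  exact ha n ((ENNReal.inv_le_inv.2 le_self_add).trans hn.le)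

end Density

section CompProd

variable {X Y : Type*} [MeasurableSpace X] [MeasurableSpace Y] {μ : Measure X} {ν : Measure Y}

theorem measurePreserving_prodMap_compProd {κ : Kernel Y X} [IsSFiniteKernel κ] [SFinite ν]
    {e : Y → Y} (he : MeasurePreserving e ν ν) {f : X → X} (hf : Measurable f)
    (hκ : ∀ᵐ y ∂ν, (κ y).map f = κ (e y)) :
    MeasurePreserving (Prod.map e f) (ν ⊗ₘ κ) (ν ⊗ₘ κ) := by
  refine ⟨he.measurable.prodMap hf, ?_⟩
  ext s hs
  rw [Measure.map_apply (he.measurable.prodMap hf) hs,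
    Measure.compProd_apply (he.measurable.prodMap hf hs), Measure.compProd_apply hs,
    ← he.lintegral_comp (Kernel.measurable_kernel_prodMk_left hs)]
  refine lintegral_congr_ae ?_
  filter_upwards [hκ] with y hy
  rw [← hy, Measure.map_apply hf (measurable_prodMk_left hs)]
  rfl

theorem ae_lintegral_eq_of_withDensity_eq_compProd [SFinite μ] [SigmaFinite ν]
    {κ : Kernel Y X} [IsSFiniteKernel κ] {f : Y × X → ℝ≥0∞} (hf : Measurable f)
    (h : (ν.prod μ).withDensity f = ν ⊗ₘ κ) :
    ∀ᵐ y ∂ν, ∫⁻ x, f (y, x) ∂μ = κ y univ := by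
  refine ae_eq_of_forall_setLIntegral_eq_of_sigmaFinite hf.lintegral_prod_right'
    (κ.measurable_coe .univ) fun s hs _ => ?_
  rw [← Measure.compProd_apply_prod hs .univ, ← h, withDensity_apply _ (hs.prod .univ),
    setLIntegral_prod _ hf.aemeasurable]
  simp only [Measure.restrict_univ]

theorem compProd_absolutelyContinuous_prod [SFinite μ] [SFinite ν] {κ : Kernel Y X}
    (hκ : ∀ᵐ y ∂ν, κ y ≪ μ) : ν ⊗ₘ κ ≪ ν.prod μ := by
  rw [← Measure.compProd_const]
  exact Measure.AbsolutelyContinuous.compProd_right (by simpa using hκ)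

end CompProd

theorem IsPoissonPointProcess.ae_kernel_eq_zero {X Y : Type*} [MeasurableSpace X]
    [MeasurableSpace Y] {μ : Measure X} {ν : Measure Y} [SigmaFinite μ] [SigmaFinite ν]
    {G : Type*} [Group G] [MulAction G X] [MeasurableConstSMul G X] [SMulInvariantMeasure G X μ]
    [MulAction G Y] [MeasurableConstSMul G Y] [SMulInvariantMeasure G Y ν]
    {P : Measure (CountableSubset X)} (hP : IsPoissonPointProcess μ P)
    [ErgodicSMul G (Y × CountableSubset X) (ν.prod P)]
    (κ : Kernel Y X) [∀ y, IsFiniteMeasure (κ y)] (hκμ : ∀ᵐ y ∂ν, κ y ≪ μ)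
    (hκ : ∀ g : G, ∀ᵐ y ∂ν, (κ y).map (g • ·) = κ (g • y)) :
    ∀ᵐ y ∂ν, κ y = 0 := by
  have := isSFiniteKernel_of_isFiniteMeasure κ
  let f : Y × X → ℝ≥0∞ := (ν ⊗ₘ κ).rnDeriv (ν.prod μ)
  have hf : Measurable f := Measure.measurable_rnDeriv _ _
  have hdensity : (ν.prod μ).withDensity f = ν ⊗ₘ κ :=
    Measure.withDensity_rnDeriv_eq _ _ (compProd_absolutelyContinuous_prod hκμ)
  have hinvariant (g : G) : (fun p => f (g • p)) =ᵐ[ν.prod μ] f :=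
    comp_ae_eq_of_measurePreserving_withDensity hf.aemeasurable
      (e := (MeasurableEquiv.smul g).prodCongr (MeasurableEquiv.smul g))
      ((measurePreserving_smul g ν).prod (measurePreserving_smul g μ))
      (hdensity ▸ measurePreserving_prodMap_compProd (measurePreserving_smul g ν)
        (measurable_const_smul g) (hκ g))
  suffices hlevel : ∀ c : ℝ≥0∞, c ≠ 0 → c ≠ ∞ → ν.prod μ {p | c ≤ f p} = 0 by
    rw [← Measure.compProd_eq_zero_iff, ← hdensity]
    exact withDensity_eq_zero_of_forall_measure_ge_eq_zero hf.aemeasurable hlevel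
  intro c hc hc_top
  refine hP.prod_eq_zero_of_preimage_smul_ae_eq (G := G) (measurableSet_le measurable_const hf)
    ?_ fun g => ?_
  · filter_upwards [ae_lintegral_eq_of_withDensity_eq_compProd hf hdensity] with y hy
    have hmarkov := meas_ge_le_lintegral_div (hf.comp measurable_prodMk_left).aemeasurable hc hc_top
      (μ := μ) (f := fun x => f (y, x))
    rw [hy] at hmarkov
    exact ne_top_of_le_ne_top (ENNReal.div_ne_top (measure_ne_top _ _) hc) hmarkov
  · exact (hinvariant g).mono fun p hp => congrArg (c ≤ ·) hp

section Lp

variable {X Y E : Type*} [MeasurableSpace X] [MeasurableSpace Y] [NormedAddCommGroup E]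
  {p : ℝ≥0∞} {μ : Measure X}

theorem continuous_eLpNorm_restrict [Fact (1 ≤ p)] (s : Set X) :
    Continuous fun f : Lp E p μ => eLpNorm f p (μ.restrict s) := by
  refine continuous_of_le_add_edist 1 ENNReal.one_ne_top fun f h => ?_
  have hmeas (f : Lp E p μ) : AEStronglyMeasurable f (μ.restrict s) :=
    (Lp.aestronglyMeasurable f).restrict
  calc eLpNorm f p (μ.restrict s)
      = eLpNorm (h + (f - h) : X → E) p (μ.restrict s) := by rw [add_sub_cancel]
    _ ≤ eLpNorm h p (μ.restrict s) + eLpNorm (f - h : X → E) p (μ.restrict s) :=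
        eLpNorm_add_le (hmeas h) ((hmeas f).sub (hmeas h)) Fact.out
    _ ≤ eLpNorm h p (μ.restrict s) + 1 * edist f h := by
        rw [one_mul, Lp.edist_def]
        gcongr
        exact Measure.restrict_le_self

/-- The measure `‖f‖ ^ p dμ` with total mass the `p`-th power of the `L^p` norm of `f`. For `p = ∞`
it is `μ`, since `∞.toReal = 0`. -/
noncomputable def normPowMeasure (p : ℝ≥0∞) (μ : Measure X) (f : X → E) : Measure X :=
  μ.withDensity fun x => ‖f x‖ₑ ^ p.toReal

theorem normPowMeasure_apply (hp₀ : p ≠ 0) (hp : p ≠ ∞) (f : X → E) {s : Set X}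
    (hs : MeasurableSet s) :
    normPowMeasure p μ f s = eLpNorm f p (μ.restrict s) ^ p.toReal := by
  rw [normPowMeasure, withDensity_apply _ hs, eLpNorm_eq_lintegral_rpow_enorm_toReal hp₀ hp,
    ← ENNReal.rpow_mul, one_div_mul_cancel (ENNReal.toReal_ne_zero.2 ⟨hp₀, hp⟩), ENNReal.rpow_one]

theorem isFiniteMeasure_normPowMeasure (hp₀ : p ≠ 0) (hp : p ≠ ∞) {f : X → E}
    (hf : MemLp f p μ) : IsFiniteMeasure (normPowMeasure p μ f) := by
  refine ⟨?_⟩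
  rw [normPowMeasure_apply hp₀ hp f .univ, Measure.restrict_univ]
  exact ENNReal.rpow_lt_top_of_nonneg ENNReal.toReal_nonneg hf.eLpNorm_ne_top

theorem normPowMeasure_eq_zero_iff (hp₀ : p ≠ 0) (hp : p ≠ ∞) {f : X → E}
    (hf : AEStronglyMeasurable f μ) : normPowMeasure p μ f = 0 ↔ f =ᵐ[μ] 0 := by
  rw [← Measure.measure_univ_eq_zero, normPowMeasure_apply hp₀ hp f .univ, Measure.restrict_univ,
    ENNReal.rpow_eq_zero_iff_of_pos (ENNReal.toReal_pos hp₀ hp), eLpNorm_eq_zero_iff hf hp₀]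

theorem map_normPowMeasure {ν : Measure Y} {e : X → Y} (he : MeasurePreserving e μ ν)
    {f : X → E} {h : Y → E} (hh : AEStronglyMeasurable h ν) (hfh : h ∘ e =ᵐ[μ] f) :
    (normPowMeasure p μ f).map e = normPowMeasure p ν h := by
  rw [normPowMeasure, normPowMeasure, ← map_withDensity_comp he (hh.enorm.pow_const p.toReal)]
  congr 1
  refine withDensity_congr_ae ?_
  filter_upwards [hfh] with x hx
  rw [← hx, comp_apply, comp_apply]

/-- The kernel sending `y` to the measure `‖Φ y‖ ^ p dμ`. It is equivariant when `Φ` is. -/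
noncomputable def normPowKernel [Fact (1 ≤ p)] (hp : p ≠ ∞) (Φ : Y → Lp E p μ)
    (hΦ : Measurable[_, borel (Lp E p μ)] Φ) : Kernel Y X where
  toFun y := normPowMeasure p μ (Φ y)
  measurable' := Measure.measurable_of_measurable_coe _ fun s hs => by
    borelize ↥(Lp E p μ)
    have hp₀ : p ≠ 0 := (zero_lt_one.trans_le Fact.out).ne'
    simp only [normPowMeasure_apply hp₀ hp _ hs]
    exact ((continuous_eLpNorm_restrict s).measurable.comp hΦ).pow_const _

end Lp

theorem mainTheorem5_general {X Y E : Type*} [MeasurableSpace X] [MeasurableSpace Y]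
    [NormedAddCommGroup E] (μ : Measure X) [SigmaFinite μ] (ν : Measure Y) [SigmaFinite ν]
    {G : Type*} [Group G] [MulAction G X] [MeasurableConstSMul G X] [SMulInvariantMeasure G X μ]
    [MulAction G Y] [MeasurableConstSMul G Y] [SMulInvariantMeasure G Y ν]
    (P : Measure (CountableSubset X)) (hP : IsPoissonPointProcess μ P)
    (hErg : ErgodicSMul G (Y × CountableSubset X) (ν.prod P))
    {p : ℝ≥0∞} [Fact (1 ≤ p)] (hp : p ≠ ∞)
    (Φ : Y → Lp E p μ) (hΦ : Measurable[_, borel (Lp E p μ)] Φ)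
    (hequiv : ∀ g : G, ∀ᵐ y ∂ν, (fun x => Φ (g • y) (g • x)) =ᵐ[μ] Φ y) :
    ∀ᵐ y ∂ν, Φ y = 0 := by
  have hp₀ : p ≠ 0 := (zero_lt_one.trans_le Fact.out).ne'
  have (y : Y) : IsFiniteMeasure (normPowKernel hp Φ hΦ y) :=
    isFiniteMeasure_normPowMeasure hp₀ hp (Lp.memLp (Φ y))
  have hzero : ∀ᵐ y ∂ν, normPowKernel hp Φ hΦ y = 0 := by
    refine hP.ae_kernel_eq_zero (G := G) _
      (.of_forall fun y => withDensity_absolutelyContinuous _ _) fun g => ?_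
    filter_upwards [hequiv g] with y hy
    exact map_normPowMeasure (measurePreserving_smul g μ) (Lp.aestronglyMeasurable _) hy
  filter_upwards [hzero] with y hy
  exact (Lp.eq_zero_iff_ae_eq_zero).2
    ((normPowMeasure_eq_zero_iff hp₀ hp (Lp.aestronglyMeasurable _)).1 hy)

theorem mainTheorem5 {𝕜 : Type*} [RCLike 𝕜]
    {X : Type*} [MeasurableSpace X] [StandardBorelSpace X]
    (μ : Measure X) [SigmaFinite μ] [NullSingletonClass μ] (hμ : μ Set.univ = ⊤)
    {G : Type*} [Group G] [MulAction G X] [MeasurableConstSMul G X] [SMulInvariantMeasure G X μ]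
    (P : Measure (CountableSubset X)) (hP : IsPoissonPointProcess μ P)
    (hErg : ErgodicSMul G (X × CountableSubset X) (μ.prod P))
    (Φ : X → Lp 𝕜 1 μ) (hΦ : Measurable[_, borel (Lp 𝕜 1 μ)] Φ)
    (hequiv : ∀ g : G, ∀ᵐ x ∂μ, (fun y => Φ (g • x) (g • y)) =ᵐ[μ] Φ x) :
    ∀ᵐ x ∂μ, Φ x = 0 :=
  mainTheorem5_general μ μ P hP hErg ENNReal.one_ne_top Φ hΦ hequiv
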